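/- Let $\mathbb{K}$ be an algebraically closed field of characteristic zero and $R=\mathbb{K}[x_0,\dots,x_n]$. Fix integers $2\le n<d$, a primitive $d$-th root of unity $e\in\mathbb{K}$, and integers $0\le\alpha_0\le\dots\le\alpha_n<d$, not all equal, with $\gcd(d,\alpha_0,\dots,\alpha_n)=1$. Let $\Gamma\subset GL(n+1,\mathbb{K})$ be the cyclic group of order $d$ generated by $\mathrm{diag}(e^{\alpha_0},\dots,e^{\alpha_n})$, and let $\overline{\Gamma}$ be the group generated by $\Gamma$ and $\mathrm{diag}(e,\dots,e)$. Let $\mu_d$ be the number of monomials of degree $d$ in $R$ that are invariant under $\Gamma$, let $I_d\subset R$ be the ideal generated by these monomials, and let $X_d\subset\mathbb{P}^{\mu_d-1}$ be the image of the morphism from $\mathbb{P}^n$ given by them. Let $\operatorname{relint}(I_d)$ be the ideal of the invariant ring $R^{\overline{\Gamma}}$ generated by all monomials $x_0^{a_0}\cdots x_n^{a_n}\in R^{\overline{\Gamma}}$ with $a_0\cdots a_n\neq 0$. Assume that $X_d$ is a level GT-variety, i.e. that $\mu_d\le\binom{d+n-1}{n-1}$ and that $\operatorname{relint}(I_d)$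 is generated by its monomials of degree $d$. Let $\eta_d$ be the number of monomials of degree $d$ in $\operatorname{relint}(I_d)$ and put $N_d=\binom{n+d}{d}-\eta_d-1$. Then there are exactly $N_d+1$ monomials of degree $d$ in $R$ outside $\operatorname{relint}(I_d)$. Let $f_d:\mathbb{P}^n\to\mathbb{P}^{N_d}$ be the morphism given by these monomials, and let $\mathcal{X}_d=f_d(\mathbb{P}^n)\subset\mathbb{P}^{N_d}$ be its image, the RL-variety associated to $X_d$. Then $f_d$ is an embedding (a closed immersion of schemes over $\mathbb{K}$), and $\mathcal{X}_d$ is a smooth rational variety over $\mathbb{K}$, birational to affine $n$-space. -/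

import Mathlib

open CategoryTheory AlgebraicGeometry MvPolynomial

attribute [local instance] MvPolynomial.gradedAlgebra

universe u

noncomputable section

/-! ### Projective space and morphisms given by monomials of a fixed degree -/

/-- Projective space over `K` with homogeneous coordinates indexed by `σ`, as a scheme. -/
abbrev ProjSpace (K : Type u) [Field K] (σ : Type) : Scheme.{u} :=
  Proj (homogeneousSubmodule σ K)

/-- The structure morphism of projective space to `Spec K`. -/
def ProjSpace.toBase (K : Type u) [Field K] (σ : Type) :
    ProjSpace K σ ⟶ Spec (CommRingCat.of K) :=
  Proj.toSpecZero (homogeneousSubmodule σ K) ≫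
    Spec.map (CommRingCat.ofHom (algebraMap K (homogeneousSubmodule σ K 0)))

section ScaledLocMap

variable {A B S T : Type*} [CommRing A] [CommRing B] [SetLike S A] [SetLike T B]
  [AddSubgroupClass S A] [AddSubgroupClass T B] (𝒜 : ℕ → S) (ℬ : ℕ → T) [GradedRing 𝒜]
  [GradedRing ℬ] (d : ℕ) (g : A →+* B) (hg : ∀ i, ∀ a ∈ 𝒜 i, g a ∈ ℬ (d * i))
  (P : Submonoid A) (Q : Submonoid B) (h : P ≤ Q.comap g)

/-- The function underlying `scaledLocMap`: it sends a fraction `a / s` to `g(a) / g(s)`. -/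
def scaledLocFun : HomogeneousLocalization 𝒜 P → HomogeneousLocalization ℬ Q :=
  Quotient.map'
    (fun x ↦ ⟨d * x.deg, ⟨g x.num, hg _ _ x.num.2⟩, ⟨g x.den, hg _ _ x.den.2⟩,
      Submonoid.mem_comap.mp (h x.den_mem)⟩)
    fun x y (e : x.embedding = y.embedding) ↦ by
      apply_fun IsLocalization.map (Localization Q) g h at e
      simp_rw [HomogeneousLocalization.NumDenSameDeg.embedding, Localization.mk_eq_mk',
        IsLocalization.map_mk', ← Localization.mk_eq_mk'] at e
      exact e

set_option linter.unusedSectionVars false in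
lemma val_scaledLocFun (z : HomogeneousLocalization 𝒜 P) :
    (scaledLocFun 𝒜 ℬ d g hg P Q h z).val = IsLocalization.map (Localization Q) g h z.val := by
  obtain ⟨x, rfl⟩ := z.mk_surjective
  rw [HomogeneousLocalization.val_mk, Localization.mk_eq_mk', IsLocalization.map_mk',
    ← Localization.mk_eq_mk']
  rfl

/-- Let `g : A → B` be a ring homomorphism between graded rings that multiplies degrees by `d`, and
let `P`, `Q` be submonoids with `g(P) ⊆ Q`. This is the map `a / s ↦ g(a) / g(s)` from the degree
zero part of `P⁻¹ A` to the degree zero part of `Q⁻¹ B`. -/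
def scaledLocMap : HomogeneousLocalization 𝒜 P →+* HomogeneousLocalization ℬ Q where
  toFun := scaledLocFun 𝒜 ℬ d g hg P Q h
  map_add' x y := by
    apply HomogeneousLocalization.val_injective
    simp [val_scaledLocFun]
  map_mul' x y := by
    apply HomogeneousLocalization.val_injective
    simp [val_scaledLocFun]
  map_zero' := by
    apply HomogeneousLocalization.val_injective
    simp [val_scaledLocFun]
  map_one' := by
    apply HomogeneousLocalization.val_injective
    simp [val_scaledLocFun]

lemma val_scaledLocMap (z : HomogeneousLocalization 𝒜 P) :
    (scaledLocMap 𝒜 ℬ d g hg P Q h z).val = IsLocalization.map (Localization Q) g h z.val :=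
  val_scaledLocFun 𝒜 ℬ d g hg P Q h z

lemma scaledLocMap_comp_awayMap {s t s' : A} {u v u' : B} {k l : ℕ}
    (ht : t ∈ 𝒜 k) (hx : s' = s * t) (hv : v ∈ ℬ l) (hy : u' = u * v)
    (h₁ : Submonoid.powers s ≤ (Submonoid.powers u).comap g)
    (h₂ : Submonoid.powers s' ≤ (Submonoid.powers u').comap g) :
    (scaledLocMap 𝒜 ℬ d g hg _ _ h₂).comp (HomogeneousLocalization.awayMap 𝒜 ht hx) =
      (HomogeneousLocalization.awayMap ℬ hv hy).comp (scaledLocMap 𝒜 ℬ d g hg _ _ h₁) := by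
  ext z
  simp only [RingHom.comp_apply, val_scaledLocMap, HomogeneousLocalization.val_awayMap]
  simp only [← RingHom.comp_apply]
  congr 1
  apply IsLocalization.ringHom_ext (M := .powers s)
  ext a
  simp [Localization.awayLift]

end ScaledLocMap

section ScaledProjMap

variable {A B S T : Type u} [CommRing A] [CommRing B] [SetLike S A] [SetLike T B]
  [AddSubgroupClass S A] [AddSubgroupClass T B] (𝒜 : ℕ → S) (ℬ : ℕ → T) [GradedRing 𝒜]
  [GradedRing ℬ] (d : ℕ) (g : A →+* B) (hg : ∀ i, ∀ a ∈ 𝒜 i, g a ∈ ℬ (d * i))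
  {ι : Type} (s : ι → A) (t : ι → B) (hs : ∀ i, s i ∈ 𝒜 1) (ht : ∀ i, t i ∈ ℬ 1)

lemma powers_le_comap_powers (hst : ∀ i, g (s i) = t i ^ d) (i : ι) :
    Submonoid.powers (s i) ≤ (Submonoid.powers (t i)).comap g := by
  rw [Submonoid.powers_le, Submonoid.mem_comap, hst]
  exact ⟨d, rfl⟩

lemma powers_mul_le_comap_powers_mul (hst : ∀ i, g (s i) = t i ^ d) (i j : ι) :
    Submonoid.powers (s i * s j) ≤ (Submonoid.powers (t i * t j)).comap g := by
  rw [Submonoid.powers_le, Submonoid.mem_comap, map_mul, hst, hst]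
  exact ⟨d, mul_pow _ _ _⟩

variable (hst : ∀ i, g (s i) = t i ^ d)
  (hspan : (HomogeneousIdeal.irrelevant ℬ).toIdeal ≤ Ideal.span (Set.range t))

/-- The morphism `scaledProjMap` on the chart `t i ≠ 0` of `Proj B`: it maps this chart to the chart
`s i ≠ 0` of `Proj A` and is given there by `a / (s i)ᵏ ↦ g(a) / g(s i)ᵏ`. -/
def scaledProjChart (i : ι) :
    Spec (CommRingCat.of (HomogeneousLocalization.Away ℬ (t i))) ⟶ Proj 𝒜 :=
  Spec.map (CommRingCat.ofHom (scaledLocMap 𝒜 ℬ d g hg _ _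
    (powers_le_comap_powers d g s t hst i))) ≫ Proj.awayι 𝒜 (s i) (hs i) one_pos

lemma SpecMap_awayMap_scaledProjChart (i j : ι) {w : A} {x : B} (hw : w = s i * s j)
    (hx : x = t i * t j) (hw2 : w ∈ 𝒜 2)
    (h : Submonoid.powers w ≤ (Submonoid.powers x).comap g) :
    Spec.map (CommRingCat.ofHom (HomogeneousLocalization.awayMap ℬ (ht j) hx)) ≫
        scaledProjChart 𝒜 ℬ d g hg s t hs hst i =
      Spec.map (CommRingCat.ofHom (scaledLocMap 𝒜 ℬ d g hg _ _ h)) ≫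
        Proj.awayι 𝒜 w hw2 two_pos := by
  rw [scaledProjChart, ← Spec.map_comp_assoc, ← CommRingCat.ofHom_comp,
    ← scaledLocMap_comp_awayMap 𝒜 ℬ d g hg (hs j) hw (ht j) hx _ h, CommRingCat.ofHom_comp,
    Spec.map_comp_assoc, Proj.SpecMap_awayMap_awayι 𝒜 (hs i) one_pos (hs j) hw]

/-- Let `g : A → B` be a homomorphism between graded rings that multiplies degrees by `d`. Suppose
that `B` has elements `t i` of degree one generating the irrelevant ideal, and `A` has elements `s i`
of degree one with `g (s i) = (t i) ^ d`. This is the induced morphism `Proj B ⟶ Proj A`, glued from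
the charts `t i ≠ 0`. -/
def scaledProjMap : Proj ℬ ⟶ Proj 𝒜 :=
  (Proj.affineOpenCoverOfIrrelevantLESpan ℬ t ht (fun _ ↦ one_pos) hspan).openCover.glueMorphisms
    (scaledProjChart 𝒜 ℬ d g hg s t hs hst) fun i j ↦ by
    change Limits.pullback.fst (Proj.awayι ℬ (t i) (ht i) one_pos)
        (Proj.awayι ℬ (t j) (ht j) one_pos) ≫ _ =
      Limits.pullback.snd (Proj.awayι ℬ (t i) (ht i) one_pos)
        (Proj.awayι ℬ (t j) (ht j) one_pos) ≫ _
    rw [← cancel_epi (Proj.pullbackAwayιIso ℬ (ht i) one_pos (ht j) one_pos rfl).inv,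
      Proj.pullbackAwayιIso_inv_fst_assoc, Proj.pullbackAwayιIso_inv_snd_assoc,
      SpecMap_awayMap_scaledProjChart 𝒜 ℬ d g hg s t hs ht hst i j rfl _
        (SetLike.mul_mem_graded (hs i) (hs j)) (powers_mul_le_comap_powers_mul d g s t hst i j),
      SpecMap_awayMap_scaledProjChart 𝒜 ℬ d g hg s t hs ht hst j i (mul_comm _ _) _
        (SetLike.mul_mem_graded (hs i) (hs j)) (powers_mul_le_comap_powers_mul d g s t hst i j)]

lemma awayι_scaledProjMap (i : ι) :
    Proj.awayι ℬ (t i) (ht i) one_pos ≫ scaledProjMap 𝒜 ℬ d g hg s t hs ht hst hspan =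
      scaledProjChart 𝒜 ℬ d g hg s t hs hst i :=
  (Proj.affineOpenCoverOfIrrelevantLESpan ℬ t ht
    (fun _ ↦ one_pos) hspan).openCover.ι_glueMorphisms _ _ i

end ScaledProjMap

section MonomialMap

variable (K : Type u) [Field K] {n d : ℕ} (S : Set (Fin (n + 1) →₀ ℕ))

/-- The ring homomorphism `K[w_a : a ∈ S] → K[x₀, …, xₙ]` sending `w_a` to the monomial `x^a`. -/
def monomialRingHom : MvPolynomial S K →+* MvPolynomial (Fin (n + 1)) K :=
  (aeval fun a : S ↦ monomial a.1 (1 : K)).toRingHom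

variable {S}

lemma monomialRingHom_mem (hS : ∀ a ∈ S, a.degree = d) (i : ℕ) (p : MvPolynomial S K)
    (hp : p ∈ homogeneousSubmodule S K i) :
    monomialRingHom K S p ∈ homogeneousSubmodule (Fin (n + 1)) K (d * i) :=
  IsHomogeneous.aeval (n := d) hp _ fun a ↦ isHomogeneous_monomial _ (hS _ a.2)

lemma monomialRingHom_X (hd : ∀ i, Finsupp.single i d ∈ S) (i : Fin (n + 1)) :
    monomialRingHom K S (X ⟨Finsupp.single i d, hd i⟩) = X i ^ d := by
  simp [monomialRingHom, X_pow_eq_monomial]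

lemma irrelevant_le_span_X (σ : Type) :
    (HomogeneousIdeal.irrelevant (homogeneousSubmodule σ K)).toIdeal ≤
      Ideal.span (Set.range (X : σ → MvPolynomial σ K)) := by
  refine (HomogeneousIdeal.toIdeal_irrelevant_le _).mpr fun i hi p hp ↦ ?_
  have hp : p.IsHomogeneous i := hp
  change p ∈ Ideal.span (Set.range X)
  rw [← Set.image_univ, mem_ideal_span_X_image]
  intro m hm
  by_contra! hc
  have hm0 : m = 0 := Finsupp.ext fun j ↦ hc j trivial
  rw [mem_support_iff, hm0] at hm
  have := hp hm
  simp at this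
  omega

lemma X_mem_one {σ : Type} (i : σ) :
    (X i : MvPolynomial σ K) ∈ homogeneousSubmodule σ K 1 :=
  isHomogeneous_X K i

/-- The morphism `ℙⁿ → ℙ(K^S)`, `x ↦ (x^a)_{a ∈ S}`, given by a set `S` of monomials of degree `d`
in `x₀, …, xₙ` that contains `x₀^d, …, xₙ^d`. -/
def monomialMap (hS : ∀ a ∈ S, a.degree = d) (hd : ∀ i, Finsupp.single i d ∈ S) :
    ProjSpace K (Fin (n + 1)) ⟶ ProjSpace K S :=
  scaledProjMap (homogeneousSubmodule S K) (homogeneousSubmodule (Fin (n + 1)) K) d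
    (monomialRingHom K S) (monomialRingHom_mem K hS) (fun i ↦ X ⟨Finsupp.single i d, hd i⟩) X
    (fun _ ↦ X_mem_one K _) (X_mem_one K) (monomialRingHom_X K hd) (irrelevant_le_span_X K _)

end MonomialMap

/-! ### Invariants of finite linear groups -/

/-- The linear substitution `xᵢ ↦ ∑ⱼ gᵢⱼ xⱼ` of the polynomial ring defined by `g ∈ GL(n+1, K)`. -/
def linSubst {K : Type u} [Field K] {n : ℕ} (g : GL (Fin (n + 1)) K) :
    MvPolynomial (Fin (n + 1)) K →ₐ[K] MvPolynomial (Fin (n + 1)) K :=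
  aeval fun i ↦ ∑ j, C (g.val i j) * X j

/-- The ring of invariants `R^G = {p ∈ R | g(p) = p for all g ∈ G}` of a subgroup `G` of
`GL(n+1, K)` acting on `R = K[x₀, …, xₙ]`. -/
def invariantRing {K : Type u} [Field K] {n : ℕ} (G : Subgroup (GL (Fin (n + 1)) K)) :
    Subalgebra K (MvPolynomial (Fin (n + 1)) K) where
  carrier := {p | ∀ g ∈ G, linSubst g p = p}
  mul_mem' hp hq g hg := by rw [map_mul, hp g hg, hq g hg]
  add_mem' hp hq g hg := by rw [map_add, hp g hg, hq g hg]
  algebraMap_mem' r g _ := by rw [AlgHom.commutes]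

/-! ### Level GT-varieties and their RL-varieties -/

/-- The data defining the cyclic group `Γ = ⟨diag(e^α₀, …, e^αₙ)⟩ ⊆ GL(n+1, K)` of order `d`: integers
`2 ≤ n < d`, a primitive `d`-th root of unity `e ∈ K`, and integers `0 ≤ α₀ ≤ ⋯ ≤ αₙ < d`, not all
equal, with `gcd(d, α₀, …, αₙ) = 1`. -/
structure CyclicDatum (K : Type u) [Field K] (n d : ℕ) where
  two_le : 2 ≤ n
  lt : n < d
  e : K
  primitive : IsPrimitiveRoot e d
  α : Fin (n + 1) → ℕ
  mono : Monotone α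
  α_lt : ∀ i, α i < d
  gcd_eq_one : Nat.gcd d (Finset.univ.gcd α) = 1
  exists_lt : ∃ i j, α i < α j

namespace CyclicDatum

variable {K : Type u} [Field K] {n d : ℕ} (D : CyclicDatum K n d)

/-- The diagonal matrix `M_{d;β₀,…,βₙ} = diag(e^β₀, …, e^βₙ)`. -/
def diag (β : Fin (n + 1) → ℕ) : GL (Fin (n + 1)) K :=
  Matrix.GeneralLinearGroup.mkOfDetNeZero (Matrix.diagonal fun i ↦ D.e ^ β i) <| by
    have he : D.e ≠ 0 := D.primitive.ne_zero (Nat.ne_zero_of_lt D.lt)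
    rw [Matrix.det_diagonal]
    exact Finset.prod_ne_zero_iff.mpr fun i _ ↦ pow_ne_zero _ he

/-- The cyclic group `Γ = ⟨M_{d;α₀,…,αₙ}⟩`. -/
def Γ : Subgroup (GL (Fin (n + 1)) K) := Subgroup.zpowers (D.diag D.α)

/-- The cyclic extension `Γ̄` of `Γ`, generated by `M_{d;α₀,…,αₙ}` and `M_{d;1,…,1}`. -/
def Γbar : Subgroup (GL (Fin (n + 1)) K) :=
  Subgroup.closure {D.diag D.α, D.diag fun _ ↦ 1}

/-- The exponents of the monomials of degree `d` that are invariant under `Γ`; these monomials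
generate the ideal `I_d` and parametrize the variety `X_d`. -/
def invariantMonomials : Set (Fin (n + 1) →₀ ℕ) :=
  {a | a.degree = d ∧ monomial a (1 : K) ∈ invariantRing D.Γ}

/-- The number `μ_d` of monomials of degree `d` that are invariant under `Γ`. -/
def μ : ℕ := D.invariantMonomials.ncard

/-- The ideal `relint(I_d)` of `R^Γ̄` generated by all monomials `x₀^a₀ ⋯ xₙ^aₙ ∈ R^Γ̄` with
`a₀ ⋯ aₙ ≠ 0`. -/
def relint : Ideal (invariantRing D.Γbar) :=
  Ideal.span {p : invariantRing D.Γbar | ∃ a : Fin (n + 1) →₀ ℕ, (∀ i, a i ≠ 0) ∧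
    (p : MvPolynomial (Fin (n + 1)) K) = monomial a 1}

/-- The exponents of the monomials of degree `kd` that lie in `relint(I_d)`. -/
def relintMonomials (k : ℕ) : Set (Fin (n + 1) →₀ ℕ) :=
  {a | a.degree = k * d ∧ ∃ p ∈ D.relint, (p : MvPolynomial (Fin (n + 1)) K) = monomial a 1}

/-- `X_d` is a GT-variety with group `Γ`: the number of generators of `I_d` satisfies
`μ_d ≤ binom(d + n - 1, n - 1)`. -/
def IsGTVariety : Prop := D.μ ≤ (d + n - 1).choose (n - 1)

/-- `X_d` is a level GT-variety: it is a GT-variety and the canonical module `relint(I_d)` of `R^Γ̄`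
is generated by its monomials of degree `d`. -/
def IsLevelGTVariety : Prop :=
  D.IsGTVariety ∧ D.relint =
    Ideal.span {p : invariantRing D.Γbar |
      ∃ a ∈ D.relintMonomials 1, (p : MvPolynomial (Fin (n + 1)) K) = monomial a 1}

/-- The number `η_d` of monomials of degree `d` in `relint(I_d)`. -/
def η : ℕ := (D.relintMonomials 1).ncard

/-- `N_d = binom(n + d, d) - η_d - 1`. -/
def N : ℕ := (n + d).choose d - D.η - 1

/-- The exponents of the monomials of degree `d` outside `relint(I_d)`. -/
def rlMonomials : Set (Fin (n + 1) →₀ ℕ) :=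
  {a | a.degree = d ∧ a ∉ D.relintMonomials 1}

lemma single_mem_rlMonomials (i : Fin (n + 1)) : Finsupp.single i d ∈ D.rlMonomials := by
  classical
  refine ⟨Finsupp.degree_single _ _, ?_⟩
  rintro ⟨-, p, hp, hpi⟩
  have : Nontrivial (Fin (n + 1)) := Fin.nontrivial_iff_two_le.mpr (by have := D.two_le; omega)
  obtain ⟨j, hj⟩ := exists_ne i
  let φ : invariantRing D.Γbar →+* K :=
    (eval (Function.update (1 : Fin (n + 1) → K) j 0)).comp (invariantRing D.Γbar).val.toRingHom
  have hle : D.relint ≤ RingHom.ker φ := by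
    refine Ideal.span_le.mpr ?_
    rintro q ⟨a, ha, hq⟩
    change eval _ (q : MvPolynomial (Fin (n + 1)) K) = 0
    rw [hq, eval_monomial, one_mul, Finsupp.prod]
    refine Finset.prod_eq_zero (i := j) (Finsupp.mem_support_iff.mpr (ha j)) ?_
    simp [ha j]
  have h0 : eval (Function.update (1 : Fin (n + 1) → K) j 0)
      (p : MvPolynomial (Fin (n + 1)) K) = 0 := hle hp
  rw [hpi, eval_monomial, one_mul, Finsupp.prod_single_index (by simp)] at h0
  simp [Function.update_of_ne hj.symm] at h0

/-- The projective space `ℙ^{N_d}`, with coordinates indexed by the monomials of degree `d` outside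
`relint(I_d)`. -/
abbrev target : Scheme.{u} := ProjSpace K D.rlMonomials

/-- The morphism `f_d : ℙⁿ → ℙ^{N_d}` given by the monomials of degree `d` outside `relint(I_d)`. -/
def f : ProjSpace K (Fin (n + 1)) ⟶ D.target :=
  monomialMap K (S := D.rlMonomials) (fun _ h ↦ h.1) D.single_mem_rlMonomials

/-- The RL-variety `𝒳_d`, the image of `f_d`, as a closed subscheme of `ℙ^{N_d}`. -/
abbrev rlVariety : Scheme.{u} := D.f.image

/-- The structure morphism of the RL-variety to `Spec K`. -/
def rlVarietyToBase : D.rlVariety ⟶ Spec (CommRingCat.of K) :=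
  D.f.imageι ≫ ProjSpace.toBase K D.rlMonomials

end CyclicDatum

end

/-! A monomial of degree `d` in `relint` involves every variable, since the generators of `relint`
vanish wherever some coordinate is zero. As `n + 1 ≥ 3`, the monomials `x_i^d` and `x_i^(d-1) x_j`,
having at most two variables, all lie outside `relint` and are coordinates of `f_d`. On the chart
`x_i ≠ 0` this gives `x_j / x_i = x_i^(d-1) x_j / x_i^d`, so the map of chart rings is surjective
(`monomialChartHom_surjective`).

To globalize, `w_i`, the coordinate of `x_i^d`, pulls back to `x_i^d`, so only points with `x_i ≠ 0`
map into the chart `w_i ≠ 0`. This gives global injectivity. Properness of `ℙⁿ` makes the map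
closed, and `isClosedImmersion_monomialMap` follows.

Hence `ℙⁿ` is isomorphic over `K` to the image of `f_d`. Integrality, smoothness and rationality are
transported from `ℙⁿ`, where they follow from charts with polynomial coordinate rings
(`chartEquiv`). -/

noncomputable section

/-! ### The standard charts of projective space -/

/-- With `u = 1 / x_i`, this turns substitution of the fractions `x_j / x_i` into `p / x_i^k`. -/
lemma MvPolynomial.IsHomogeneous.eval₂_mul_left {σ R S : Type*} [CommSemiring R] [CommSemiring S]
    {p : MvPolynomial σ R} {k : ℕ} (hp : p.IsHomogeneous k) (f : R →+* S) (u : S) (g : σ → S) :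
    p.eval₂ f (fun j ↦ u * g j) = u ^ k * p.eval₂ f g := by
  rw [eval₂_eq, eval₂_eq, Finset.mul_sum]
  refine Finset.sum_congr rfl fun a ha ↦ ?_
  have hk : ∑ j ∈ a.support, a j = k := by
    by_contra h
    exact mem_support_iff.mp ha (hp.coeff_eq_zero h)
  simp_rw [mul_pow, Finset.prod_mul_distrib, Finset.prod_pow_eq_pow_sum, hk]
  ring

section Chart

variable (K : Type u) [Field K] {σ : Type}

/-- The embedding of the scalars into the coordinate ring of the chart `xᵢ ≠ 0`. -/
def chartScalars (i : σ) :
    K →+* HomogeneousLocalization.Away (homogeneousSubmodule σ K) (X i) :=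
  (HomogeneousLocalization.fromZeroRingHom (homogeneousSubmodule σ K) _).comp
    (algebraMap K (homogeneousSubmodule σ K 0))

/-- The function `xⱼ / xᵢ` on the chart `xᵢ ≠ 0`. -/
def chartCoord (i j : σ) : HomogeneousLocalization.Away (homogeneousSubmodule σ K) (X i) :=
  HomogeneousLocalization.Away.mk _ (X_mem_one K i) 1 (X j) (by simpa using X_mem_one K j)

lemma val_chartScalars (i : σ) (r : K) :
    (chartScalars K i r).val = algebraMap (MvPolynomial σ K) _ (C r) :=
  rfl

lemma val_chartCoord (i j : σ) :
    (chartCoord K i j).val =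
      IsLocalization.Away.invSelf (X i : MvPolynomial σ K) * algebraMap (MvPolynomial σ K) _ (X j) := by
  rw [chartCoord, HomogeneousLocalization.Away.val_mk, ← Localization.mk_one_eq_algebraMap,
    IsLocalization.Away.invSelf, ← Localization.mk_eq_mk', Localization.mk_mul]
  simp

lemma chartCoord_self (i : σ) : chartCoord K i i = 1 := by
  apply HomogeneousLocalization.val_injective
  rw [chartCoord, HomogeneousLocalization.Away.val_mk, HomogeneousLocalization.val_one]
  simp_rw [pow_one]
  exact Localization.mk_self (⟨X i, Submonoid.mem_powers _⟩ :
    Submonoid.powers (X i : MvPolynomial σ K))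

lemma eval₂_chartCoord (i : σ) {k : ℕ} {p : MvPolynomial σ K}
    (hp : p ∈ homogeneousSubmodule σ K (k • 1)) :
    p.eval₂ (chartScalars K i) (chartCoord K i) =
      HomogeneousLocalization.Away.mk _ (X_mem_one K i) k p hp := by
  apply HomogeneousLocalization.val_injective
  have hp' : p.IsHomogeneous k := by simpa using hp
  rw [← HomogeneousLocalization.algebraMap_apply, ← coe_eval₂Hom, ← RingHom.comp_apply,
    comp_eval₂Hom]
  have h1 : (algebraMap _ (Localization.Away (X i : MvPolynomial σ K))).comp (chartScalars K i) =
    (algebraMap (MvPolynomial σ K) _).comp C := rfl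
  have h2 : (fun j ↦ algebraMap _ (Localization.Away (X i : MvPolynomial σ K))
      (chartCoord K i j)) = fun j ↦ IsLocalization.Away.invSelf (X i : MvPolynomial σ K) *
        algebraMap (MvPolynomial σ K) _ (X j) := funext fun j ↦ val_chartCoord K i j
  rw [h1, h2, coe_eval₂Hom, hp'.eval₂_mul_left, ← coe_eval₂Hom]
  have h3 : eval₂Hom ((algebraMap (MvPolynomial σ K) (Localization.Away (X i : MvPolynomial σ K))).comp C)
      (fun j ↦ algebraMap (MvPolynomial σ K) (Localization.Away (X i : MvPolynomial σ K)) (X j)) =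
      algebraMap _ _ := by
    ext <;> simp
  rw [h3, HomogeneousLocalization.Away.val_mk, ← Localization.mk_one_eq_algebraMap,
    IsLocalization.Away.invSelf, ← Localization.mk_eq_mk', Localization.mk_pow, Localization.mk_mul]
  simp

/-- Every element of the chart ring is some `p / x_i^k` with `p` homogeneous of degree `k`, hence a
polynomial in the fractions `x_j / x_i`. Applied to ranges, this is the surjectivity criterion. -/
lemma chart_induction (i : σ) (R : Subring
    (HomogeneousLocalization.Away (homogeneousSubmodule σ K) (X i)))
    (hC : ∀ r, chartScalars K i r ∈ R) (hX : ∀ j, chartCoord K i j ∈ R) : R = ⊤ := by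
  refine eq_top_iff.mpr fun z _ ↦ ?_
  obtain ⟨k, p, hp, rfl⟩ := HomogeneousLocalization.Away.mk_surjective _ (X_mem_one K i) z
  rw [← eval₂_chartCoord, eval₂_eq]
  exact sum_mem fun a _ ↦ mul_mem (hC _) (prod_mem fun j _ ↦ pow_mem (hX j) _)

/-! ### Chart rings of `ℙⁿ` as polynomial rings. -/

variable {n : ℕ}

/-- The ring homomorphism from `K[y₁, …, yₙ]` to the coordinate ring of the chart `xᵢ ≠ 0` of `ℙⁿ`
sending the variables to the fractions `xⱼ / xᵢ` with `j ≠ i`. -/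
def chartHom (i : Fin (n + 1)) : MvPolynomial (Fin n) K →+*
    HomogeneousLocalization.Away (homogeneousSubmodule (Fin (n + 1)) K) (X i) :=
  eval₂Hom (chartScalars K i) fun j ↦ chartCoord K i (i.succAbove j)

/-- The dehomogenization `xᵢ ↦ 1`. -/
def dehomogenize (i : Fin (n + 1)) :
    HomogeneousLocalization.Away (homogeneousSubmodule (Fin (n + 1)) K) (X i) →+*
      MvPolynomial (Fin n) K :=
  (Localization.awayLift (aeval (R := K) (Fin.insertNth i 1 X :
    Fin (n + 1) → MvPolynomial (Fin n) K)).toRingHom (X i) (by simp)).comp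
    (algebraMap _ (Localization.Away (X i)))

/-- A one-sided inverse suffices: it gives injectivity of `chartHom`, while surjectivity comes from
generators. -/
lemma dehomogenize_chartHom (i : Fin (n + 1)) (p : MvPolynomial (Fin n) K) :
    dehomogenize K i (chartHom K i p) = p := by
  have : (dehomogenize K i).comp (chartHom K i) = RingHom.id _ := by
    ext j
    · simp [chartHom, dehomogenize, val_chartScalars, Localization.awayLift]
    · simp only [chartHom, dehomogenize, chartCoord, Localization.awayLift, Localization.mk_eq_mk',
        IsLocalization.Away.lift, RingHom.comp_apply, coe_eval₂Hom, eval₂_X,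
        HomogeneousLocalization.algebraMap_apply, HomogeneousLocalization.Away.val_mk,
        RingHom.id_apply]
      congr 1
      rw [IsLocalization.lift_mk'_spec]
      simp
  exact congr($this p)

lemma chartHom_surjective (i : Fin (n + 1)) : Function.Surjective (chartHom K i) := by
  rw [← RingHom.range_eq_top]
  refine chart_induction K i _ (fun r ↦ ⟨C r, by simp [chartHom]⟩) fun j ↦ ?_
  cases j using Fin.succAboveCases i with
  | x => exact ⟨1, by rw [map_one, chartCoord_self]⟩
  | p j => exact ⟨X j, by simp [chartHom]⟩

/-- The coordinate ring of a standard chart of `ℙⁿ` is a polynomial ring in `n` variables. -/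
def chartEquiv (i : Fin (n + 1)) : MvPolynomial (Fin n) K ≃+*
    HomogeneousLocalization.Away (homogeneousSubmodule (Fin (n + 1)) K) (X i) :=
  RingEquiv.ofBijective (chartHom K i)
    ⟨Function.LeftInverse.injective (dehomogenize_chartHom K i), chartHom_surjective K i⟩

lemma chartEquiv_C (i : Fin (n + 1)) (r : K) : chartEquiv K i (C r) = chartScalars K i r := by
  simp [chartEquiv, chartHom]

end Chart

/-! ### Geometry of projective space -/

namespace ProjSpace

section General

variable (K : Type u) [Field K] (σ : Type)

/-- The covering of projective space by the standard charts. -/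
def openCover : (ProjSpace K σ).OpenCover :=
  (Proj.affineOpenCoverOfIrrelevantLESpan (homogeneousSubmodule σ K) X (X_mem_one K)
    (fun _ ↦ one_pos) (irrelevant_le_span_X K σ)).openCover

/-- The standard chart `xᵢ ≠ 0` of projective space. -/
abbrev chart (i : σ) :
    Spec (CommRingCat.of (HomogeneousLocalization.Away (homogeneousSubmodule σ K) (X i))) ⟶
      ProjSpace K σ :=
  Proj.awayι (homogeneousSubmodule σ K) (X i) (X_mem_one K i) one_pos

variable {K σ} in
lemma hom_ext {Y : Scheme.{u}} {g h : ProjSpace K σ ⟶ Y}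
    (H : ∀ i, chart K σ i ≫ g = chart K σ i ≫ h) : g = h :=
  (openCover K σ).hom_ext _ _ H

variable {K σ} in
lemma exists_chart_eq (x : ProjSpace K σ) : ∃ i y, chart K σ i y = x :=
  (openCover K σ).exists_eq x

variable {σ} in
lemma chart_toBase (i : σ) :
    chart K σ i ≫ toBase K σ = Spec.map (CommRingCat.ofHom (chartScalars K i)) := by
  rw [toBase, Proj.awayι_toSpecZero_assoc, ← Spec.map_comp, ← CommRingCat.ofHom_comp]
  rfl

lemma surjective_algebraMap_zero :
    Function.Surjective (algebraMap K (homogeneousSubmodule σ K 0)) := by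
  rintro ⟨p, hp⟩
  rw [homogeneousSubmodule_zero, Submodule.mem_one] at hp
  obtain ⟨r, rfl⟩ := hp
  exact ⟨r, rfl⟩

/-- This is the second factor of `toBase`; being a closed immersion, it lets separatedness and
properness pass from `Proj.toSpecZero` to `toBase`. -/
instance isClosedImmersion_SpecMap_algebraMap_zero : IsClosedImmersion
    (Spec.map (CommRingCat.ofHom (algebraMap K (homogeneousSubmodule σ K 0)))) :=
  IsClosedImmersion.spec_of_surjective _ (surjective_algebraMap_zero K σ)

instance isSeparated_toBase : IsSeparated (toBase K σ) := by
  unfold toBase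
  infer_instance

instance isProper_toBase [Finite σ] : IsProper (toBase K σ) := by
  have : IsScalarTower K (homogeneousSubmodule σ K 0) (MvPolynomial σ K) :=
    .of_algebraMap_eq (S := homogeneousSubmodule σ K 0) fun _ ↦ rfl
  have : Algebra.FiniteType (homogeneousSubmodule σ K 0) (MvPolynomial σ K) :=
    .of_restrictScalars_finiteType K _ _
  unfold toBase
  infer_instance

/-- The generic point of projective space. -/
def genericPoint [Nonempty σ] : ProjSpace K σ where
  asHomogeneousIdeal := ⊥
  isPrime := Ideal.isPrime_bot
  not_irrelevant_le h := by
    have : (X (Classical.arbitrary σ) : MvPolynomial σ K) ∈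
        (⊥ : HomogeneousIdeal (homogeneousSubmodule σ K)) := by
      refine h ?_
      rw [HomogeneousIdeal.mem_irrelevant_iff]
      rw [GradedRing.proj_apply]
      exact DirectSum.decompose_of_mem_ne _ (X_mem_one K _) one_ne_zero
    exact X_ne_zero _ ((HomogeneousIdeal.mem_iff ..).mp this)

instance irreducibleSpace [Nonempty σ] : IrreducibleSpace (ProjSpace K σ) := by
  -- The zero ideal is contained in every homogeneous prime.
  have h : closure {genericPoint K σ} = Set.univ := by
    refine Set.eq_univ_of_forall fun y ↦ ?_
    exact (ProjectiveSpectrum.le_iff_mem_closure _ _ y).mp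
      (show (⊥ : HomogeneousIdeal (homogeneousSubmodule σ K)) ≤ _ from bot_le)
  have : IsIrreducible (Set.univ : Set (ProjSpace K σ)) := h ▸ isIrreducible_singleton.closure
  exact (irreducibleSpace_def _).mpr this

end General

/-! ### Integrality, smoothness and affine charts of `ℙⁿ`. -/

variable (K : Type u) [Field K] (n : ℕ)

lemma isReduced_chart (i : Fin (n + 1)) : AlgebraicGeometry.IsReduced (Spec (CommRingCat.of
    (HomogeneousLocalization.Away (homogeneousSubmodule (Fin (n + 1)) K) (X i)))) := by
  have : _root_.IsReduced (HomogeneousLocalization.Away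
      (homogeneousSubmodule (Fin (n + 1)) K) (X i)) :=
    isReduced_of_injective (chartEquiv K i).symm (chartEquiv K i).symm.injective
  infer_instance

instance isIntegral : IsIntegral (ProjSpace K (Fin (n + 1))) := by
  have (i : (openCover K (Fin (n + 1))).I₀) :
      AlgebraicGeometry.IsReduced ((openCover K (Fin (n + 1))).X i) := isReduced_chart K n i
  have := IsReduced.of_openCover _ (openCover K (Fin (n + 1)))
  exact isIntegral_of_irreducibleSpace_of_isReduced _

lemma smooth_chart_toBase (i : Fin (n + 1)) :
    Smooth (chart K (Fin (n + 1)) i ≫ toBase K (Fin (n + 1))) := by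
  rw [chart_toBase, HasRingHomProperty.Spec_iff (P := @Smooth)]
  have hs : Algebra.Smooth K (MvPolynomial (Fin n) K) := ⟨inferInstance, inferInstance⟩
  let : Algebra K (HomogeneousLocalization.Away (homogeneousSubmodule (Fin (n + 1)) K) (X i)) :=
    (chartScalars K i).toAlgebra
  exact Algebra.Smooth.of_equiv (R := K) (A := MvPolynomial (Fin n) K)
    (AlgEquiv.ofRingEquiv (f := chartEquiv K i) (R := K) (chartEquiv_C K i))

instance smooth_toBase : Smooth (toBase K (Fin (n + 1))) := by
  have := HasRingHomProperty.instIsZariskiLocalAtSource (P := @Smooth)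
  rw [IsZariskiLocalAtSource.iff_of_openCover (P := @Smooth) (openCover K (Fin (n + 1)))]
  exact smooth_chart_toBase K n

/-- The standard chart of `ℙⁿ` as an open immersion from affine space. -/
def affineChart (i : Fin (n + 1)) :
    𝔸(ULift.{u} (Fin n); Spec (CommRingCat.of K)) ⟶ ProjSpace K (Fin (n + 1)) :=
  (AffineSpace.SpecIso (ULift.{u} (Fin n)) (CommRingCat.of K)).hom ≫
    Spec.map (((chartEquiv K i).symm.trans
      (renameEquiv K Equiv.ulift.symm).toRingEquiv).toCommRingCatIso.hom) ≫ chart K _ i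

instance (i : Fin (n + 1)) : IsOpenImmersion (affineChart K n i) := by
  unfold affineChart
  infer_instance

lemma affineChart_toBase (i : Fin (n + 1)) :
    affineChart K n i ≫ toBase K (Fin (n + 1)) =
      𝔸(ULift.{u} (Fin n); Spec (CommRingCat.of K)) ↘ Spec (CommRingCat.of K) := by
  rw [affineChart, Category.assoc, Category.assoc, chart_toBase, ← Spec.map_comp,
    ← Iso.eq_inv_comp, AffineSpace.SpecIso_inv_over]
  congr 1
  refine CommRingCat.hom_ext (RingHom.ext fun r ↦ ?_)
  change rename _ ((chartEquiv K i).symm (chartScalars K i r)) = C r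
  rw [← chartEquiv_C, RingEquiv.symm_apply_apply]
  exact rename_C _ _

end ProjSpace

/-- A nonempty open subscheme of an irreducible scheme is dense. -/
lemma isDominant_of_isOpenImmersion {X Y : Scheme.{u}} (g : X ⟶ Y) [IsOpenImmersion g]
    [Nonempty X] [IrreducibleSpace Y] : IsDominant g :=
  ⟨(g.isOpenEmbedding.isOpen_range).dense (Set.range_nonempty _)⟩

/-! ### Morphisms given by monomials -/

section MonomialMap

variable (K : Type u) [Field K] {n d : ℕ} {S : Set (Fin (n + 1) →₀ ℕ)}
  (hS : ∀ a ∈ S, a.degree = d) (hd : ∀ i, Finsupp.single i d ∈ S)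

/-- The map of coordinate rings describing `monomialMap` on the chart `xᵢ ≠ 0`. -/
def monomialChartHom (i : Fin (n + 1)) :
    HomogeneousLocalization.Away (homogeneousSubmodule S K) (X ⟨Finsupp.single i d, hd i⟩) →+*
      HomogeneousLocalization.Away (homogeneousSubmodule (Fin (n + 1)) K) (X i) :=
  scaledLocMap (homogeneousSubmodule S K) (homogeneousSubmodule (Fin (n + 1)) K) d
    (monomialRingHom K S) (monomialRingHom_mem K hS) _ _
    (powers_le_comap_powers d (monomialRingHom K S)
      (fun i ↦ X ⟨Finsupp.single i d, hd i⟩) X (monomialRingHom_X K hd) i)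

lemma chart_monomialMap (i : Fin (n + 1)) :
    ProjSpace.chart K _ i ≫ monomialMap K hS hd =
      Spec.map (CommRingCat.ofHom (monomialChartHom K hS hd i)) ≫
        ProjSpace.chart K S ⟨Finsupp.single i d, hd i⟩ :=
  awayι_scaledProjMap ..

lemma monomialChartHom_scalars (i : Fin (n + 1)) (r : K) :
    monomialChartHom K hS hd i (chartScalars K _ r) = chartScalars K i r := by
  apply HomogeneousLocalization.val_injective
  rw [monomialChartHom, val_scaledLocMap, val_chartScalars, val_chartScalars, IsLocalization.map_eq]
  congr 1
  simp [monomialRingHom]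

/-- The hypothesis `h` encodes `x^a = x_i^(d-1) x_j` without truncated subtraction, and it allows `i
= j`. -/
lemma monomialChartHom_coord (i j : Fin (n + 1)) {a : Fin (n + 1) →₀ ℕ} (ha : a ∈ S)
    (h : a + Finsupp.single i 1 = Finsupp.single i d + Finsupp.single j 1) :
    monomialChartHom K hS hd i (chartCoord K _ ⟨a, ha⟩) = chartCoord K i j := by
  apply HomogeneousLocalization.val_injective
  rw [monomialChartHom, val_scaledLocMap, chartCoord, chartCoord,
    HomogeneousLocalization.Away.val_mk, HomogeneousLocalization.Away.val_mk,
    Localization.mk_eq_mk', IsLocalization.map_mk', ← Localization.mk_eq_mk',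
    Localization.mk_eq_mk_iff, Localization.r_iff_exists]
  refine ⟨1, ?_⟩
  simp only [OneMemClass.coe_one, one_mul, pow_one, monomialRingHom_X]
  simp only [monomialRingHom, AlgHom.toRingHom_eq_coe, RingHom.coe_coe, aeval_X]
  simp only [X, monomial_pow, monomial_mul, one_pow, mul_one]
  rw [add_comm _ a, h]
  simp

lemma monomialMap_toBase :
    monomialMap K hS hd ≫ ProjSpace.toBase K S = ProjSpace.toBase K (Fin (n + 1)) := by
  refine ProjSpace.hom_ext fun i ↦ ?_
  rw [← Category.assoc, chart_monomialMap, Category.assoc, ProjSpace.chart_toBase,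
    ProjSpace.chart_toBase, ← Spec.map_comp, ← CommRingCat.ofHom_comp]
  congr 2
  ext1 r
  exact monomialChartHom_scalars K hS hd i r

/-! ### A criterion for a monomial morphism to be a closed immersion. -/

variable (h0 : d ≠ 0)

include h0 in
-- On the chart `x_k ≠ 0`, the function `w_i / w_k` pulls back to `(x_i / x_k)^d`, and for `d > 0` a
-- prime avoiding this power avoids its base.
lemma monomialMap_preimage_basicOpen (i : Fin (n + 1)) :
    monomialMap K hS hd ⁻¹ᵁ Proj.basicOpen (homogeneousSubmodule S K)
      (X ⟨Finsupp.single i d, hd i⟩) ≤ Proj.basicOpen (homogeneousSubmodule (Fin (n + 1)) K) (X i) := by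
  intro x hx
  obtain ⟨k, y, rfl⟩ := ProjSpace.exists_chart_eq x
  rw [← Scheme.Hom.mem_preimage]
  have hy : y ∈ (ProjSpace.chart K _ k ≫ monomialMap K hS hd) ⁻¹ᵁ
    Proj.basicOpen (homogeneousSubmodule S K) (X ⟨Finsupp.single i d, hd i⟩) := hx
  rw [Proj.awayι_preimage_basicOpen _ _ _ (X_mem_one K i) one_pos]
  rw [chart_monomialMap, Scheme.Hom.comp_preimage,
    Proj.awayι_preimage_basicOpen _ _ _ (X_mem_one K _) one_pos] at hy
  have hy : monomialChartHom K hS hd k (HomogeneousLocalization.Away.isLocalizationElem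
    (X_mem_one K (⟨Finsupp.single k d, hd k⟩ : S)) (X_mem_one K ⟨Finsupp.single i d, hd i⟩)) ∉
      y.asIdeal := hy
  change HomogeneousLocalization.Away.isLocalizationElem (X_mem_one K k) (X_mem_one K i) ∉ y.asIdeal
  have h : monomialChartHom K hS hd k (HomogeneousLocalization.Away.isLocalizationElem
    (X_mem_one K (⟨Finsupp.single k d, hd k⟩ : S)) (X_mem_one K ⟨Finsupp.single i d, hd i⟩)) =
      HomogeneousLocalization.Away.isLocalizationElem (X_mem_one K k) (X_mem_one K i) ^ d := by
    apply HomogeneousLocalization.val_injective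
    rw [monomialChartHom, val_scaledLocMap, HomogeneousLocalization.val_pow,
      HomogeneousLocalization.Away.val_mk, HomogeneousLocalization.Away.val_mk,
      Localization.mk_eq_mk', IsLocalization.map_mk', ← Localization.mk_eq_mk',
      Localization.mk_pow]
    congr 1
    · rw [map_pow, monomialRingHom_X, pow_right_comm]
    · ext1
      simp [monomialRingHom_X]
  rw [h] at hy
  exact fun hm ↦ hy (Ideal.pow_mem_of_mem _ hm d (Nat.pos_of_ne_zero h0))

variable (hS1 : ∀ i j, ∃ a ∈ S, a + Finsupp.single i 1 = Finsupp.single i d + Finsupp.single j 1)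

include hS1 in
lemma monomialChartHom_surjective (i : Fin (n + 1)) :
    Function.Surjective (monomialChartHom K hS hd i) := by
  rw [← RingHom.range_eq_top]
  refine chart_induction K i _ (fun r ↦ ⟨_, monomialChartHom_scalars K hS hd i r⟩) fun j ↦ ?_
  obtain ⟨a, ha, h⟩ := hS1 i j
  exact ⟨_, monomialChartHom_coord K hS hd i j ha h⟩

include hS1 in
-- A closed immersion into the chart `w_i ≠ 0` followed by an open immersion.
lemma isPreimmersion_chart_monomialMap (i : Fin (n + 1)) :
    IsPreimmersion (ProjSpace.chart K _ i ≫ monomialMap K hS hd) := by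
  have : IsClosedImmersion (Spec.map (CommRingCat.ofHom (monomialChartHom K hS hd i))) :=
    .spec_of_surjective _ (monomialChartHom_surjective K hS hd hS1 i)
  rw [chart_monomialMap]
  infer_instance

include h0 hS1 in
lemma monomialMap_injective : Function.Injective (monomialMap K hS hd) := by
  intro x y hxy
  obtain ⟨i, x, rfl⟩ := ProjSpace.exists_chart_eq x
  have hx : ProjSpace.chart K _ i x ∈ monomialMap K hS hd ⁻¹ᵁ
      Proj.basicOpen (homogeneousSubmodule S K) (X ⟨Finsupp.single i d, hd i⟩) := by
    rw [Scheme.Hom.mem_preimage, ← Scheme.Hom.comp_apply, chart_monomialMap, Scheme.Hom.comp_apply,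
      ← Proj.opensRange_awayι _ _ (X_mem_one K _) one_pos]
    exact ⟨_, rfl⟩
  -- The common image lies in `w_i ≠ 0`, which forces `y` into the chart of `x`, where injectivity
  -- is known.
  have hy : y ∈ Proj.basicOpen (homogeneousSubmodule (Fin (n + 1)) K) (X i) := by
    refine monomialMap_preimage_basicOpen K hS hd h0 i ?_
    rwa [Scheme.Hom.mem_preimage, ← hxy]
  rw [← Proj.opensRange_awayι _ _ (X_mem_one K _) one_pos] at hy
  obtain ⟨y, rfl⟩ := hy
  have := (isPreimmersion_chart_monomialMap K hS hd hS1 i).isEmbedding.injective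
  exact congr(ProjSpace.chart K _ i $(this (by simpa using hxy)))

include hS1 in
lemma surjectiveOnStalks_monomialMap : SurjectiveOnStalks (monomialMap K hS hd) := by
  rw [IsZariskiLocalAtSource.iff_of_openCover (P := @SurjectiveOnStalks)
    (ProjSpace.openCover K (Fin (n + 1)))]
  exact fun i ↦ (isPreimmersion_chart_monomialMap K hS hd hS1 i).toSurjectiveOnStalks

include h0 hS1 in
/-- A set of monomials of degree `d > 0` containing all `xᵢ^d` and all `xᵢ^(d-1) xⱼ` defines a closed
embedding of projective space. -/
theorem isClosedImmersion_monomialMap : IsClosedImmersion (monomialMap K hS hd) := by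
  -- The composite is the proper structure morphism of `ℙⁿ`. Cancelling the second factor requires
  -- only that the target be separated, so no finiteness of `S` enters.
  have h : UniversallyClosed (monomialMap K hS hd ≫ ProjSpace.toBase K S) := by
    rw [monomialMap_toBase]
    infer_instance
  have := UniversallyClosed.of_comp_of_isSeparated (monomialMap K hS hd) (ProjSpace.toBase K S)
  have h2 := surjectiveOnStalks_monomialMap K hS hd hS1
  have hc := Scheme.Hom.isClosedMap (monomialMap K hS hd)
  have hp : IsPreimmersion (monomialMap K hS hd) :=
    { h2 with
      isEmbedding := (Topology.IsClosedEmbedding.of_continuous_injective_isClosedMap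
        (monomialMap K hS hd).continuous (monomialMap_injective K hS hd h0 hS1) hc).isEmbedding }
  exact .of_isPreimmersion _ hc.isClosed_range

end MonomialMap

/-! ### RL-varieties -/

namespace CyclicDatum

variable {K : Type u} [Field K] {n d : ℕ} (D : CyclicDatum K n d)

/-- Evaluation at the point with `x_j = 0` and all other coordinates `1` kills every generator of
`relint`, but takes the value `1` on a monomial free of `x_j`. -/
lemma ne_zero_of_mem_relintMonomials {k : ℕ} {a : Fin (n + 1) →₀ ℕ}
    (ha : a ∈ D.relintMonomials k) (j : Fin (n + 1)) : a j ≠ 0 := by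
  obtain ⟨-, p, hp, hpa⟩ := ha
  intro hj
  let φ : invariantRing D.Γbar →+* K :=
    (eval (Function.update (1 : Fin (n + 1) → K) j 0)).comp (invariantRing D.Γbar).val.toRingHom
  have hle : D.relint ≤ RingHom.ker φ := by
    refine Ideal.span_le.mpr ?_
    rintro q ⟨b, hb, hq⟩
    change eval _ (q : MvPolynomial (Fin (n + 1)) K) = 0
    rw [hq, eval_monomial, one_mul, Finsupp.prod]
    refine Finset.prod_eq_zero (i := j) (Finsupp.mem_support_iff.mpr (hb j)) ?_
    simp [hb j]
  have h0 : eval (Function.update (1 : Fin (n + 1) → K) j 0)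
      (p : MvPolynomial (Fin (n + 1)) K) = 0 := hle hp
  rw [hpa, eval_monomial, one_mul, Finsupp.prod] at h0
  refine Finset.prod_ne_zero_iff.mpr (fun i hi ↦ ?_) h0
  rw [Function.update_of_ne]
  · simp
  · rintro rfl
    exact Finsupp.mem_support_iff.mp hi hj

lemma exists_mem_rlMonomials (i j : Fin (n + 1)) : ∃ a ∈ D.rlMonomials,
    a + Finsupp.single i 1 = Finsupp.single i d + Finsupp.single j 1 := by
  have hd : d - 1 + 1 = d := Nat.sub_add_cancel (Nat.one_le_of_lt D.lt)
  refine ⟨Finsupp.single i (d - 1) + Finsupp.single j 1, ⟨?_, fun h ↦ ?_⟩, ?_⟩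
  · rw [map_add, Finsupp.degree_single, Finsupp.degree_single, hd]
  -- Here `2 ≤ n` is essential: some third variable does not occur in `x_i^(d-1) x_j`.
  · obtain ⟨k, hk⟩ : ∃ k, k ∉ ({i, j} : Finset (Fin (n + 1))) := by
      by_contra! hk
      have h1 := Finset.card_le_card (fun k _ ↦ hk k : Finset.univ ⊆ ({i, j} : Finset (Fin (n + 1))))
      have h2 := Finset.card_le_two (a := i) (b := j)
      rw [Finset.card_univ, Fintype.card_fin] at h1
      have := D.two_le
      omega
    simp only [Finset.mem_insert, Finset.mem_singleton, not_or] at hk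
    refine D.ne_zero_of_mem_relintMonomials h k ?_
    simp [Ne.symm hk.1, Ne.symm hk.2]
  · rw [add_right_comm, ← Finsupp.single_add, hd]

lemma card_rlMonomials : Nat.card D.rlMonomials = D.N + 1 := by
  classical
  have hs : {a : Fin (n + 1) →₀ ℕ | a.degree = d} =
      (Finset.univ.finsuppAntidiag d : Finset (Fin (n + 1) →₀ ℕ)) := by
    ext a
    simp [Finset.mem_finsuppAntidiag, Finsupp.degree_eq_sum]
  have hfin : {a : Fin (n + 1) →₀ ℕ | a.degree = d}.Finite := hs ▸ Finset.finite_toSet _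
  have hcard : {a : Fin (n + 1) →₀ ℕ | a.degree = d}.ncard = (n + d).choose d := by
    rw [hs, Set.ncard_coe_finset, Finset.card_finsuppAntidiag_nat_eq_choose, Finset.card_univ,
      Fintype.card_fin]
    congr 1
    omega
  have hsub : D.relintMonomials 1 ⊆ {a | a.degree = d} := fun a ha ↦ by simpa using ha.1
  have hdiff : D.rlMonomials = {a : Fin (n + 1) →₀ ℕ | a.degree = d} \ D.relintMonomials 1 := rfl
  have h1 := Set.ncard_sdiff_add_ncard_of_subset hsub hfin
  -- Nonemptiness, witnessed by `x_0^d`, ensures that the truncated `- 1` in `N` loses nothing.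
  have h2 : 0 < D.rlMonomials.ncard :=
    (Set.ncard_pos (hfin.subset fun a ha ↦ ha.1)).mpr ⟨_, D.single_mem_rlMonomials 0⟩
  rw [Nat.card_coe_set_eq, N, η]
  rw [← hdiff, hcard] at h1
  omega

lemma f_toBase : D.f ≫ ProjSpace.toBase K D.rlMonomials = ProjSpace.toBase K (Fin (n + 1)) :=
  monomialMap_toBase K _ _

instance isClosedImmersion_f : IsClosedImmersion D.f :=
  isClosedImmersion_monomialMap K _ _ (Nat.ne_zero_of_lt D.lt) D.exists_mem_rlMonomials

lemma toImage_toBase : D.f.toImage ≫ D.rlVarietyToBase = ProjSpace.toBase K (Fin (n + 1)) := by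
  rw [rlVarietyToBase, Scheme.Hom.toImage_imageι_assoc, f_toBase]

/-- A scheme-theoretic image may in general exceed the set-theoretic one; here `toImage` is
surjective, so no points are added. -/
lemma range_imageι : Set.range D.f.imageι = Set.range D.f := by
  conv_rhs => rw [← D.f.toImage_imageι]
  rw [Scheme.Hom.comp_base, TopCat.coe_comp, Set.range_comp, D.f.toImage.surjective.range_eq,
    Set.image_univ]

instance isIntegral_rlVariety : IsIntegral D.rlVariety :=
  have : Nonempty D.rlVariety := ⟨D.f.toImage (ProjSpace.genericPoint K _)⟩
  -- As `f` is a closed immersion, `toImage` is an isomorphism, and its inverse is in particular an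
  -- open immersion into the integral scheme `ℙⁿ`.
  isIntegral_of_isOpenImmersion (inv D.f.toImage)

lemma smooth_rlVarietyToBase : Smooth D.rlVarietyToBase := by
  rw [← (IsIso.inv_comp_eq _).mpr D.toImage_toBase.symm]
  infer_instance

lemma birationalOver_rlVariety : Scheme.BirationalOver D.rlVarietyToBase
    (𝔸(ULift.{u} (Fin n); Spec (CommRingCat.of K)) ↘ Spec (CommRingCat.of K)) := by
  have : Nonempty 𝔸(ULift.{u} (Fin n); Spec (CommRingCat.of K)) :=
    (AffineSpace.SpecIso (ULift.{u} (Fin n)) (CommRingCat.of K)).hom.homeomorph.nonempty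
  -- Affine space, embedded as the chart `x_0 ≠ 0`, is a nonempty open and hence dense subscheme of
  -- the irreducible RL-variety.
  have := isDominant_of_isOpenImmersion (ProjSpace.affineChart K n 0 ≫ D.f.toImage)
  refine (Scheme.Hom.birationalOver (ProjSpace.affineChart K n 0 ≫ D.f.toImage) _ _ ?_).symm
  rw [Category.assoc, toImage_toBase, ProjSpace.affineChart_toBase]

end CyclicDatum

end

theorem mainTheorem5 {K : Type u} [Field K] [IsAlgClosed K] [CharZero K] {n d : ℕ}
    (D : CyclicDatum K n d) (hD : D.IsLevelGTVariety) :
    -- the target of `f_d` has `N_d + 1` homogeneous coordinates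
    Nat.card D.rlMonomials = D.N + 1 ∧
    -- `f_d` is a closed embedding of schemes over `K`, whose image is the set `𝒳_d`
    D.f ≫ ProjSpace.toBase K D.rlMonomials = ProjSpace.toBase K (Fin (n + 1)) ∧
    IsClosedImmersion D.f ∧
    Set.range D.f.imageι = Set.range D.f ∧
    -- `𝒳_d` is a smooth variety over `K`
    IsIntegral D.rlVariety ∧
    Smooth D.rlVarietyToBase ∧
    -- `𝒳_d` is rational, of dimension `n`
    Scheme.BirationalOver D.rlVarietyToBase
      (𝔸(ULift.{u} (Fin n); Spec (CommRingCat.of K)) ↘ Spec (CommRingCat.of K)) :=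
  ⟨D.card_rlMonomials, D.f_toBase, D.isClosedImmersion_f, D.range_imageι, D.isIntegral_rlVariety,
    D.smooth_rlVarietyToBase, D.birationalOver_rlVariety⟩
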